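/- **Setting.** Let $N, K \ge 1$. A server holds $N$ files $W_1,\dots,W_N$, independent and uniform on $[2^F]$, where the file size $F$ is a positive integer, and there are $K$ users. Let $M \ge 0$ and $\mathbf R = (R_{\mathbf d})_{\mathbf d\in[N]^K}$ with all $R_{\mathbf d}\ge 0$. An $(M,\mathbf R)$ caching scheme with file size $F$ consists of a cache encoder $w \mapsto (z_1(w),\dots,z_K(w))$ with $z_k(w)\in[2^{\lfloor FM\rfloor}]$, an update encoder $(w,\mathbf d)\mapsto x_{\mathbf d}(w)\in[2^{\lfloor FR_{\mathbf d}\rfloor}]$, and $K$ decoders, the $k$-th of which maps $(z_k,x_{\mathbf d},\mathbf d)$ to an estimate $\hat w_{d_k}\in[2^F]$. Its error probability is $\mathsf P_{\mathsf e}=\max_{\mathbf d\in[N]^K}\max_{k\in[K]}\mathbb P(\hat W_{d_k}\ne W_{d_k})$. The tuple $(M,\mathbf R)$ is achievable if for every $\epsilon>0$ there is, for some large enough file size $F$, an $(M,\mathbf R)$ caching scheme with $\mathsf P_{\mathsf e}<\epsilon$. The optimal rate region $\mathcal R^\star$ is the closure of the set of achievable tuples. Let the requests $D_1,\dots,D_K$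 be i.i.d. with law $p_D$ on $[N]$, where $p_D(1)\ge p_D(2)\ge\cdots\ge p_D(N)$. The optimal average rate at memory $M$ is $$R^\star_{\mathsf{avg}}(M)=\min_{\mathbf R:\,(M,\mathbf R)\in\mathcal R^\star}\ \sum_{\mathbf d\in[N]^K}\Big(\prod_{k=1}^K p_D(d_k)\Big)R_{\mathbf d}.$$ **Theorem.** For all $M\ge 0$ this minimum is attained, and $$R^\star_{\mathsf{avg}}(M)\ \ge\ \max_{k\in[K]}\ \sum_{n=1}^N\big(s_n(k)-s_{n+1}(k)\big)\,(n-kM)^+,$$ where $s_n(k)=1-(1-p_D(n))^k$ for $n\in[N]$, $s_{N+1}(k)=0$, and $x^+=\max\{x,0\}$. -/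

import Mathlib

namespace CodedCaching

noncomputable section

/-- A tuple of requests, one for each of the `K` users, from a library of `N` files. -/
abbrev Demand (N K : ℕ) : Type := Fin K → Fin N

/-- A realization of the library: `N` files of `F` bits, each an element of a set of size `2 ^ F`. -/
abbrev Files (N F : ℕ) : Type := Fin N → Fin (2 ^ F)

/-- An `(M, R)` caching scheme with file size `F` bits, for `N` files and `K` users: a cache
encoder, an update encoder, and `K` decoders. The decoder of user `k` sees the demand tuple, the
content of its own cache and the update message. -/
structure Scheme (N K F : ℕ) (M : ℝ) (R : Demand N K → ℝ) where
  cache : Fin K → Files N F → Fin (2 ^ ⌊(F : ℝ) * M⌋₊)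
  update : (d : Demand N K) → Files N F → Fin (2 ^ ⌊(F : ℝ) * R d⌋₊)
  decode : Fin K → (d : Demand N K) →
    Fin (2 ^ ⌊(F : ℝ) * M⌋₊) → Fin (2 ^ ⌊(F : ℝ) * R d⌋₊) → Fin (2 ^ F)

namespace Scheme

variable {N K F : ℕ} {M : ℝ} {R : Demand N K → ℝ}

/-- The estimate that user `k` forms of its requested file, if the files are `w`. -/
def estimate (S : Scheme N K F M R) (d : Demand N K) (k : Fin K) (w : Files N F) : Fin (2 ^ F) :=
  S.decode k d (S.cache k w) (S.update d w)

/-- The probability that user `k` decodes wrongly under demand `d`, for independent files that are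
uniform on the `2 ^ F` values, so that the tuple `w` is uniform on `Files N F`. -/
def userError (S : Scheme N K F M R) (d : Demand N K) (k : Fin K) : ℝ :=
  (Finset.card {w : Files N F | S.estimate d k w ≠ w (d k)} : ℝ) / Fintype.card (Files N F)

/-- The probability of error: the maximum over all demands and all users. -/
def error (S : Scheme N K F M R) : ℝ :=
  ⨆ q : Demand N K × Fin K, S.userError q.1 q.2

end Scheme

/-- The tuple `(M, R)` of nonnegative reals is achievable: for every `ε > 0` there are a file size
`F ≥ 1` and an `(M, R)` caching scheme with that file size and error probability below `ε`.
(`F` may be taken as large as needed; asking moreover that it exceed a prescribed bound changes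
nothing, as schemes can be concatenated.) -/
def Achievable (N K : ℕ) (M : ℝ) (R : Demand N K → ℝ) : Prop :=
  0 ≤ M ∧ (∀ d, 0 ≤ R d) ∧
    ∀ ε : ℝ, 0 < ε → ∃ F : ℕ, 1 ≤ F ∧ ∃ S : Scheme N K F M R, S.error < ε

/-- The optimal rate region: the closure of the set of achievable tuples. -/
def rateRegion (N K : ℕ) : Set (ℝ × (Demand N K → ℝ)) :=
  closure {x | Achievable N K x.1 x.2}

/-- The law of `K` independent requests with common law `p`. -/
def iidLaw {N : ℕ} (K : ℕ) (p : Fin N → ℝ) (d : Demand N K) : ℝ :=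
  ∏ k, p (d k)

/-- The average rates `∑ d, q d * R d` of the tuples `R` that the optimal rate region contains at
memory `M`, when the demands have law `q`. -/
def avgRates {N K : ℕ} (q : Demand N K → ℝ) (M : ℝ) : Set ℝ :=
  {r | ∃ R : Demand N K → ℝ, (M, R) ∈ rateRegion N K ∧ r = ∑ d, q d * R d}

/-- The optimal average rate at memory `M`, when the demands have law `q`. -/
def optAvgRate {N K : ℕ} (q : Demand N K → ℝ) (M : ℝ) : ℝ :=
  sInf (avgRates q M)

/-- The probability `1 - (1 - p n) ^ k` that `k` independent requests contain file `n`, extended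
by `0` beyond the last file. Files are numbered from `0`. -/
def reqProb {N : ℕ} (p : Fin N → ℝ) (k n : ℕ) : ℝ :=
  if h : n < N then 1 - (1 - p ⟨n, h⟩) ^ k else 0

/-- The bound from the cooperation of `k` users. Files are numbered from `0`, so that `n + 1` is
the number of files up to and including file `n`. -/
def cutBound {N : ℕ} (p : Fin N → ℝ) (M : ℝ) (k : ℕ) : ℝ :=
  ∑ n ∈ Finset.range N,
    (reqProb p k n - reqProb p k (n + 1)) * max (((n + 1 : ℕ) : ℝ) - k * M) 0

end

end CodedCaching

/-! Fix k and a scheme with small error, and put the uniform law on the libraries that all users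
decode correctly under all demands (`Good`). Decoding is then exact, so Fano's inequality is not
needed; the only price is a term `log (1 - δ)`, independent of F.

Let H T be the joint entropy of the files in T and the first k caches. Under demand d, the update
and these caches determine the files requested by the first k users, so H (requested) - H ∅ is at
most F R_d log 2. By submodularity it is at least the sum, over requested files i, of the increments
H (Iic i) - H (Iio i) (`sum_increment_le_of_submodular`). Averaging over d weights file i by
`reqProb`, and Abel summation turns increments into initial segments (`sum_reqProb_mul_le`). For the
n most popular files, H exceeds H ∅ by at least F (n - kM) log 2 + log (1 - δ) (`le_filesEnt_sub`);
sorting of p makes the weights nonnegative.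

Continuity carries the bound to the closure. The minimum is attained because rates can be truncated
at N, which leaves a compact set. -/

namespace CodedCaching

open Finset

/-! ### Shannon entropy under a uniform law, by counting fibres. -/

section Entropy

variable {Ω α β γ : Type*} [Fintype Ω]

open Classical in
/-- The number of points of `Ω` at which `f` takes the value `a`. -/
noncomputable def count (f : Ω → α) (a : α) : ℕ := #{ω | f ω = a}

/-- The Shannon entropy, in nats, of `f` under the uniform law on `Ω`. -/
noncomputable def ent (f : Ω → α) : ℝ :=
  Real.log (Fintype.card Ω) - (∑ ω, Real.log (count f (f ω))) / Fintype.card Ω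

lemma count_self_pos (f : Ω → α) (ω : Ω) : 0 < count f (f ω) :=
  Finset.card_pos.mpr ⟨ω, by simp⟩

lemma ent_le_of_determines {f : Ω → α} {g : Ω → β} (h : ∀ ω ω', f ω = f ω' → g ω = g ω') :
    ent g ≤ ent f := by
  unfold ent
  gcongr with ω
  · exact_mod_cast count_self_pos f ω
  · apply Finset.card_le_card
    intro ω' hω'
    simp only [mem_filter, mem_univ, true_and] at hω' ⊢
    exact h _ _ hω'

lemma ent_eq_log_card_of_injective {f : Ω → α} (hf : Function.Injective f) :
    ent f = Real.log (Fintype.card Ω) := by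
  have h (ω : Ω) : count f (f ω) = 1 := by
    classical
    rw [count, Finset.card_eq_one]
    exact ⟨ω, by ext; simp [hf.eq_iff]⟩
  simp [ent, h]

/-- Each attained value a occurs `count f a` times and so contributes φ a. Together with log x ≤ x -
1 this yields the Gibbs-type inequalities below. -/
lemma sum_div_count_le [Fintype α] (f : Ω → α) (φ : α → ℝ) (hφ : ∀ a, 0 ≤ φ a) :
    ∑ ω, φ (f ω) / count f (f ω) ≤ ∑ a, φ a := by
  classical
  rw [Finset.sum_comp (fun a => φ a / (count f a : ℝ)) f]
  refine (Finset.sum_le_sum (g := φ) fun a ha => ?_).trans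
    (Finset.sum_le_sum_of_subset_of_nonneg (subset_univ _) fun a _ _ => hφ a)
  obtain ⟨ω, -, rfl⟩ := Finset.mem_image.mp ha
  have h0 : (0 : ℝ) < count f (f ω) := by exact_mod_cast count_self_pos f ω
  have h1 : (#{a ∈ (univ : Finset Ω) | f a = f ω}) = count f (f ω) := by
    unfold count; congr!
  rw [h1, nsmul_eq_mul, mul_div_cancel₀ _ h0.ne']

lemma ent_le_log_card [Fintype α] [Nonempty Ω] (f : Ω → α) :
    ent f ≤ Real.log (Fintype.card α) := by
  have hΩ : (0 : ℝ) < Fintype.card Ω := by exact_mod_cast Fintype.card_pos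
  have : Nonempty α := .map f inferInstance
  have hα : (0 : ℝ) < Fintype.card α := by exact_mod_cast Fintype.card_pos
  have key (ω : Ω) : Real.log (Fintype.card Ω) - Real.log (Fintype.card α)
      - Real.log (count f (f ω)) ≤
      (Fintype.card Ω / Fintype.card α : ℝ) / count f (f ω) - 1 := by
    have h0 : (0 : ℝ) < count f (f ω) := by exact_mod_cast count_self_pos f ω
    rw [← Real.log_div hΩ.ne' hα.ne', ← Real.log_div (by positivity) h0.ne']
    exact Real.log_le_sub_one_of_pos (by positivity)
  have hs := Finset.sum_le_sum fun ω (_ : ω ∈ univ) => key ω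
  have h1 := sum_div_count_le f (fun _ => (Fintype.card Ω / Fintype.card α : ℝ))
    (fun _ => by positivity)
  simp only [sum_sub_distrib, sum_const, card_univ, nsmul_eq_mul, mul_one] at hs h1
  rw [mul_div_cancel₀ _ hα.ne'] at h1
  have h2 : Fintype.card Ω * (Real.log (Fintype.card Ω) - Real.log (Fintype.card α)) ≤
      ∑ ω, Real.log (count f (f ω)) := by linarith
  rw [mul_comm, ← le_div_iff₀ hΩ] at h2
  unfold ent
  linarith

lemma sum_count_prod [Fintype α] (f : Ω → α) (h : Ω → γ) (c : γ) :
    ∑ a, count (fun ω => (f ω, h ω)) (a, c) = count h c := by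
  classical
  unfold count
  rw [Finset.card_eq_sum_card_fiberwise (f := f) (t := univ) (fun _ _ => by simp)]
  refine Finset.sum_congr rfl fun a _ => ?_
  congr 1
  ext ω
  simp [and_comm]

lemma sum_count [Fintype α] (f : Ω → α) : ∑ a, count f a = Fintype.card Ω := by
  classical
  rw [← Finset.card_univ, Finset.card_eq_sum_card_fiberwise (f := f) (t := univ)
    (fun _ _ => by simp)]
  unfold count
  congr!

/-- Conditional mutual information is nonnegative. -/
lemma ent_submodular [Fintype α] [Fintype β] [Fintype γ] [Nonempty Ω]
    (f : Ω → α) (g : Ω → β) (h : Ω → γ) :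
    ent (fun ω => (f ω, g ω, h ω)) + ent h ≤
      ent (fun ω => (f ω, h ω)) + ent (fun ω => (g ω, h ω)) := by
  have hΩ : (0 : ℝ) < Fintype.card Ω := by exact_mod_cast Fintype.card_pos
  set fh := fun ω => (f ω, h ω) with hfh
  set gh := fun ω => (g ω, h ω) with hgh
  set fgh := fun ω => (f ω, g ω, h ω) with hfgh
  -- Up to the factor |Ω|, the law that makes f and g conditionally independent given h.
  let φ : α × β × γ → ℝ := fun x => count fh (x.1, x.2.2) * count gh x.2 / count h x.2.2
  have key (ω : Ω) : Real.log (count fh (fh ω)) + Real.log (count gh (gh ω))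
      - Real.log (count h (h ω)) - Real.log (count fgh (fgh ω)) ≤
      φ (fgh ω) / count fgh (fgh ω) - 1 := by
    have h1 : (0 : ℝ) < count fh (fh ω) := by exact_mod_cast count_self_pos fh ω
    have h2 : (0 : ℝ) < count gh (gh ω) := by exact_mod_cast count_self_pos gh ω
    have h3 : (0 : ℝ) < count h (h ω) := by exact_mod_cast count_self_pos h ω
    have h4 : (0 : ℝ) < count fgh (fgh ω) := by exact_mod_cast count_self_pos fgh ω
    rw [← Real.log_mul h1.ne' h2.ne', ← Real.log_div (by positivity) h3.ne',
      ← Real.log_div (by positivity) h4.ne']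
    exact Real.log_le_sub_one_of_pos (by positivity)
  have hφ : ∑ x, φ x = Fintype.card Ω := by
    calc ∑ x, φ x = ∑ c, (∑ a, (count fh (a, c) : ℝ)) * (∑ b, (count gh (b, c) : ℝ))
          / count h c := by
          simp only [φ, Fintype.sum_prod_type, Finset.sum_mul_sum, Finset.sum_div]
          exact (Finset.sum_comm.trans (Finset.sum_congr rfl fun a _ => Finset.sum_comm)).symm
      _ = ∑ c, (count h c : ℝ) := by
          refine Finset.sum_congr rfl fun c _ => ?_
          -- Values c that h never takes are harmless: 0 * 0 / 0 = 0.
          rw [← Nat.cast_sum, ← Nat.cast_sum, sum_count_prod, sum_count_prod, mul_self_div_self]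
      _ = _ := by exact_mod_cast sum_count h
  have hs := Finset.sum_le_sum fun ω (_ : ω ∈ univ) => key ω
  have h1 := sum_div_count_le fgh φ (fun _ => by positivity)
  simp only [sum_sub_distrib, sum_add_distrib, sum_const, card_univ, nsmul_eq_mul, mul_one] at hs
  have h2 := div_nonneg (a := ∑ ω, Real.log (count h (h ω)) + ∑ ω, Real.log (count fgh (fgh ω))
    - ∑ ω, Real.log (count fh (fh ω)) - ∑ ω, Real.log (count gh (gh ω))) (by linarith) hΩ.le
  rw [sub_div, sub_div, add_div] at h2
  unfold ent
  linarith

lemma ent_prod_le [Fintype α] [Fintype β] [Nonempty Ω] (f : Ω → α) (g : Ω → β) :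
    ent (fun ω => (f ω, g ω)) ≤ ent f + ent g := by
  have h := ent_submodular f g (fun _ : Ω => ())
  have h0 : 0 ≤ ent (fun _ : Ω => ()) := by
    simp [ent, count]
  have h1 : ent (fun ω => (f ω, g ω)) ≤ ent (fun ω => (f ω, g ω, ())) :=
    ent_le_of_determines (by simp +contextual)
  have h2 : ent (fun ω => (f ω, ())) ≤ ent f := ent_le_of_determines (by simp +contextual)
  have h3 : ent (fun ω => (g ω, ())) ≤ ent g := ent_le_of_determines (by simp +contextual)
  linarith

end Entropy

end CodedCaching

namespace CodedCaching

open Finset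

/-! ### Submodular set functions and their increments. -/

section SubsetEntropy

variable {Ω ι A ζ : Type*} [Fintype Ω]

/-- The joint entropy of `Z` and the variables `W i` with `i ∈ S`. -/
noncomputable def jointEnt (W : Ω → ι → A) (Z : Ω → ζ) (S : Finset ι) : ℝ :=
  ent fun ω => ((fun i : S => W ω i), Z ω)

lemma jointEnt_mono (W : Ω → ι → A) (Z : Ω → ζ) : Monotone (jointEnt W Z) := by
  intro S T hST
  refine ent_le_of_determines fun ω ω' h => ?_
  simp only [Prod.mk.injEq, funext_iff, Subtype.forall] at h ⊢
  exact ⟨fun i hi => h.1 i (hST hi), h.2⟩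

lemma jointEnt_empty (W : Ω → ι → A) (Z : Ω → ζ) : jointEnt W Z ∅ = ent Z := by
  refine le_antisymm (ent_le_of_determines fun ω ω' h => ?_)
    (ent_le_of_determines fun ω ω' h => (Prod.mk.inj h).2)
  simp only [Prod.mk.injEq]
  exact ⟨Subsingleton.elim _ _, h⟩

variable [Nonempty Ω] [DecidableEq ι] [Fintype A] [Fintype ζ]

lemma jointEnt_submodular (W : Ω → ι → A) (Z : Ω → ζ) (S T : Finset ι) :
    jointEnt W Z (S ∪ T) + jointEnt W Z (S ∩ T) ≤ jointEnt W Z S + jointEnt W Z T := by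
  have h := ent_submodular (fun ω => fun i : S => W ω i) (fun ω => fun i : T => W ω i)
    (fun ω => ((fun i : (S ∩ T : Finset ι) => W ω i), Z ω))
  refine le_trans (add_le_add_left (ent_le_of_determines fun ω ω' h => ?_) _) <|
    h.trans (add_le_add (ent_le_of_determines fun ω ω' h => ?_)
      (ent_le_of_determines fun ω ω' h => ?_)) <;>
  · simp only [Prod.mk.injEq, funext_iff, Subtype.forall, mem_union, mem_inter] at h ⊢
    grind

end SubsetEntropy

/-- Build S in increasing order: adding `a` to a subset of `Iio a` gains at least as much as adding
it to all of `Iio a`. -/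
lemma sum_increment_le_of_submodular {ι : Type*} [LinearOrder ι] [LocallyFiniteOrderBot ι]
    {H : Finset ι → ℝ} (hH : ∀ S T, H (S ∪ T) + H (S ∩ T) ≤ H S + H T) (S : Finset ι) :
    ∑ i ∈ S, (H (Iic i) - H (Iio i)) ≤ H S - H ∅ := by
  induction S using Finset.induction_on_max with
  | empty => simp
  | insert a S ha ih =>
    have haS : a ∉ S := fun h => lt_irrefl _ (ha a h)
    rw [Finset.sum_insert haS]
    have h1 : insert a S ∪ Iio a = Iic a := by
      ext i
      simp only [mem_union, mem_insert, mem_Iio, mem_Iic, le_iff_lt_or_eq]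
      have := ha i
      tauto
    have h2 : insert a S ∩ Iio a = S := by
      ext i
      simp only [mem_inter, mem_insert, mem_Iio]
      have := ha i
      have : i = a → ¬ i < a := fun h => by simp [h]
      tauto
    have h3 := hH (insert a S) (Iio a)
    rw [h1, h2] at h3
    linarith

lemma sum_mul_increment (s G : ℕ → ℝ) (m : ℕ) :
    ∑ n ∈ range m, s n * (G (n + 1) - G n) =
      ∑ n ∈ range m, (s n - s (n + 1)) * (G (n + 1) - G 0) + s m * (G m - G 0) := by
  induction m with
  | zero => simp
  | succ m ih => rw [sum_range_succ, sum_range_succ, ih]; ring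

/-! ### Random demands and popularity. -/

section Requests

variable {N K : ℕ} {p : Fin N → ℝ}

lemma le_one_of_sum_eq_one (hp : ∀ n, 0 ≤ p n) (hs : ∑ n, p n = 1) (n : Fin N) : p n ≤ 1 :=
  hs ▸ single_le_sum (fun i _ => hp i) (mem_univ n)

lemma reqProb_antitone (hp : ∀ n, 0 ≤ p n) (hs : ∑ n, p n = 1) (hanti : Antitone p)
    (k n : ℕ) : reqProb p k (n + 1) ≤ reqProb p k n := by
  unfold reqProb
  split_ifs with h1 h2 h2
  · have h3 : p ⟨n + 1, h1⟩ ≤ p ⟨n, h2⟩ := hanti (by simp)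
    have := le_one_of_sum_eq_one hp hs ⟨n, h2⟩
    gcongr
  · omega
  · have h3 := le_one_of_sum_eq_one hp hs ⟨n, h2⟩
    have h4 : (1 - p ⟨n, h2⟩) ^ k ≤ 1 := pow_le_one₀ (by linarith) (by linarith [hp ⟨n, h2⟩])
    linarith
  · exact le_rfl

lemma reqProb_eq_zero (k : ℕ) : reqProb p k N = 0 := by simp [reqProb]

lemma reqProb_zero_le_one (hp : ∀ n, 0 ≤ p n) (hs : ∑ n, p n = 1) (k : ℕ) :
    reqProb p k 0 ≤ 1 := by
  unfold reqProb
  split_ifs with h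
  · have : 0 ≤ (1 - p ⟨0, h⟩) ^ k :=
      pow_nonneg (by linarith [le_one_of_sum_eq_one hp hs ⟨0, h⟩]) _
    linarith
  · exact zero_le_one

lemma iidLaw_nonneg (hp : ∀ n, 0 ≤ p n) (d : Demand N K) : 0 ≤ iidLaw K p d :=
  prod_nonneg fun _ _ => hp _

lemma sum_iidLaw (hs : ∑ n, p n = 1) : ∑ d, iidLaw K p d = 1 := by
  simp only [iidLaw]
  rw [← Fintype.piFinset_univ, Finset.sum_prod_piFinset]
  simp [hs]

/-- The files requested by the first `k` users. -/
def requested (k : ℕ) (d : Demand N K) : Finset (Fin N) :=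
  ({i : Fin K | (i : ℕ) < k} : Finset (Fin K)).image d

lemma sum_iidLaw_requested (hs : ∑ n, p n = 1) {k : ℕ} (hk : k ≤ K) (n : Fin N) :
    ∑ d, iidLaw K p d * (if n ∈ requested k d then 1 else 0) = reqProb p k n := by
  -- Pass to the complement: the law of missing n is a product over users, with a constraint only on
  -- the first k.
  have h1 (d : Demand N K) : iidLaw K p d * (if n ∈ requested k d then 1 else 0) =
      iidLaw K p d - ∏ i : Fin K, (if (i : ℕ) < k ∧ d i = n then 0 else p (d i)) := by
    split_ifs with h
    · simp only [requested, mem_image, mem_filter, mem_univ, true_and] at h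
      obtain ⟨i, hi⟩ := h
      rw [Finset.prod_eq_zero (mem_univ i) (by simp [hi])]
      ring
    · simp only [requested, mem_image, mem_filter, mem_univ, true_and, not_exists] at h
      simp [h, iidLaw]
  have h2 : ∑ d : Demand N K, ∏ i : Fin K, (if (i : ℕ) < k ∧ d i = n then 0 else p (d i)) =
      ∏ i : Fin K, if (i : ℕ) < k then 1 - p n else 1 := by
    rw [← Fintype.piFinset_univ, Finset.sum_prod_piFinset univ
      (fun (i : Fin K) m => if (i : ℕ) < k ∧ m = n then 0 else p m)]
    refine prod_congr rfl fun i _ => ?_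
    split_ifs with hi
    · have : ∀ m, (if (i : ℕ) < k ∧ m = n then 0 else p m) = p m - if m = n then p m else 0 := by
        intro m; by_cases hm : m = n <;> simp [hi, hm]
      simp [this, sum_sub_distrib, hs]
    · simp [hi, hs]
  have h3 : #{i : Fin K | (i : ℕ) < k} = k := by
    rw [Fin.card_filter_val_lt]; omega
  rw [sum_congr rfl fun d _ => h1 d, sum_sub_distrib, sum_iidLaw hs, h2, prod_ite]
  simp [h3, reqProb]

/-- A submodular function of sets of files, averaged over the sets of requested files, is bounded
below by its values on the sets of the most popular files. -/
lemma sum_reqProb_mul_le (hp : ∀ n, 0 ≤ p n) (hs : ∑ n, p n = 1)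
    {H : Finset (Fin N) → ℝ} (hH : ∀ S T, H (S ∪ T) + H (S ∩ T) ≤ H S + H T)
    {k : ℕ} (hk : k ≤ K) :
    ∑ n ∈ range N, (reqProb p k n - reqProb p k (n + 1)) * (H {i | (i : ℕ) < n + 1} - H ∅) ≤
      ∑ d, iidLaw K p d * (H (requested k d) - H ∅) := by
  let G : ℕ → ℝ := fun n => H {i | (i : ℕ) < n}
  have hG0 : G 0 = H ∅ := by simp [G]
  have hA := sum_mul_increment (reqProb p k) G N
  rw [reqProb_eq_zero, zero_mul, add_zero, hG0, Finset.sum_range] at hA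
  change ∑ n ∈ range N, (reqProb p k n - reqProb p k (n + 1)) * (G (n + 1) - H ∅) ≤ _
  rw [← hA]
  calc ∑ i : Fin N, reqProb p k i * (G (i + 1) - G i)
      = ∑ i : Fin N, (∑ d, iidLaw K p d * (if i ∈ requested k d then 1 else 0)) *
          (H (Iic i) - H (Iio i)) := by
        refine sum_congr rfl fun i _ => ?_
        rw [sum_iidLaw_requested hs hk]
        have h1 : ({j : Fin N | (j : ℕ) < i + 1} : Finset (Fin N)) = Iic i := by
          ext j; simp
        have h2 : ({j : Fin N | (j : ℕ) < i} : Finset (Fin N)) = Iio i := by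
          ext j; simp
        simp only [G, h1, h2]
    _ = ∑ d, iidLaw K p d * ∑ i ∈ requested k d, (H (Iic i) - H (Iio i)) := by
        simp_rw [sum_mul]
        rw [sum_comm]
        refine sum_congr rfl fun d _ => ?_
        simp [mul_sum, ite_mul, -sum_sub_distrib]
    _ ≤ _ := by
        gcongr with d
        · exact iidLaw_nonneg hp d
        · exact sum_increment_le_of_submodular hH _

end Requests

end CodedCaching

namespace CodedCaching

open Finset

variable {N K F : ℕ} {M : ℝ} {R : Demand N K → ℝ}

/-! ### The converse for a single scheme. -/

namespace Scheme

/-- The realizations of the library for which no user errs under any demand. -/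
abbrev Good (S : Scheme N K F M R) : Type :=
  {w : Files N F // ∀ d k, S.estimate d k w = w (d k)}

variable (S : Scheme N K F M R)

lemma userError_nonneg (d : Demand N K) (k : Fin K) : 0 ≤ S.userError d k := by
  unfold userError; positivity

lemma userError_le_error (d : Demand N K) (k : Fin K) : S.userError d k ≤ S.error :=
  le_ciSup (f := fun q : Demand N K × Fin K => S.userError q.1 q.2)
    (Set.finite_range _).bddAbove (d, k)

lemma error_nonneg : 0 ≤ S.error :=
  Real.iSup_nonneg fun q => S.userError_nonneg q.1 q.2

open Classical in
-- Union bound over all pairs of a demand and a user.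
lemma card_files_sub_le_card_good :
    (1 - Fintype.card (Demand N K × Fin K) * S.error) * Fintype.card (Files N F) ≤
      Fintype.card S.Good := by
  have h0 : (0 : ℝ) < Fintype.card (Files N F) := by exact_mod_cast Fintype.card_pos
  have h1 : (univ : Finset (Files N F)) ⊆ ({w | ∀ d k, S.estimate d k w = w (d k)} : Finset _) ∪
      univ.biUnion fun q : Demand N K × Fin K => {w | S.estimate q.1 q.2 w ≠ w (q.1 q.2)} := by
    intro w _
    simp only [mem_union, mem_filter, mem_univ, true_and, mem_biUnion, Prod.exists]
    by_contra! h
    obtain ⟨⟨d, k, h1⟩, h2⟩ := h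
    exact h1 (h2 d k)
  have h2 := (card_le_card h1).trans (card_union_le _ _)
  have h3 : ((#(univ.biUnion fun q : Demand N K × Fin K =>
      ({w | S.estimate q.1 q.2 w ≠ w (q.1 q.2)} : Finset (Files N F))) : ℕ) : ℝ) ≤
      Fintype.card (Demand N K × Fin K) * (S.error * Fintype.card (Files N F)) := by
    refine (Nat.cast_le.mpr card_biUnion_le).trans ?_
    rw [Nat.cast_sum, ← nsmul_eq_mul, ← card_univ]
    refine sum_le_card_nsmul _ _ _ fun q _ => ?_
    have h := S.userError_le_error q.1 q.2
    rw [userError, div_le_iff₀ h0] at h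
    convert h
  rw [card_univ] at h2
  have h4 : (Fintype.card (Files N F) : ℝ) ≤ Fintype.card S.Good + _ :=
    (Nat.cast_le.mpr (h2.trans_eq (by rw [Fintype.card_subtype]))).trans_eq (Nat.cast_add _ _)
  linarith

variable [Nonempty S.Good]

/-- The contents of the caches of the first `k` users. -/
def caches (k : ℕ) (w : S.Good) (i : {i : Fin K // (i : ℕ) < k}) : Fin (2 ^ ⌊(F : ℝ) * M⌋₊) :=
  S.cache i w.1

/-- The joint entropy of a set of files and the caches of the first `k` users. -/
noncomputable def filesEnt (k : ℕ) (T : Finset (Fin N)) : ℝ :=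
  jointEnt (fun w : S.Good => w.1) (S.caches k) T

lemma log_two_pow_floor_le {x : ℝ} (hx : 0 ≤ x) :
    Real.log (Fintype.card (Fin (2 ^ ⌊(F : ℝ) * x⌋₊))) ≤ F * Real.log 2 * x := by
  have h := Nat.floor_le (mul_nonneg F.cast_nonneg hx)
  have h2 := Real.log_nonneg one_le_two
  rw [Fintype.card_fin, Nat.cast_pow, Real.log_pow, Nat.cast_ofNat]
  nlinarith

lemma filesEnt_requested_le {k : ℕ} (d : Demand N K) (hR : 0 ≤ R d) :
    S.filesEnt k (requested k d) - S.filesEnt k ∅ ≤ F * Real.log 2 * R d := by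
  have h1 : S.filesEnt k (requested k d) ≤ ent fun w : S.Good => (S.update d w.1, S.caches k w) := by
    refine ent_le_of_determines fun w w' h => ?_
    simp only [Prod.mk.injEq] at h ⊢
    refine ⟨funext fun ⟨n, hn⟩ => ?_, h.2⟩
    simp only [requested, mem_image, mem_filter, mem_univ, true_and] at hn
    obtain ⟨i, hi, rfl⟩ := hn
    have h2 := congrFun h.2 ⟨i, hi⟩
    simp only [caches] at h2
    change w.1 (d i) = w'.1 (d i)
    rw [← w.2 d i, ← w'.2 d i, estimate, estimate, h.1, h2]
  have h2 := ent_prod_le (fun w : S.Good => S.update d w.1) (S.caches k)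
  have h3 := ent_le_log_card (fun w : S.Good => S.update d w.1)
  have h4 : S.filesEnt k ∅ = ent (S.caches k) := jointEnt_empty _ _
  have h5 := log_two_pow_floor_le (F := F) hR
  linarith

/-- The whole library has entropy log |Good|; discard the N - n other files, F bits each, and the k
caches. -/
lemma le_filesEnt_sub {k n : ℕ} (hk : k ≤ K) (hn : n ≤ N) (hM : 0 ≤ M) :
    Real.log (Fintype.card S.Good) - F * Real.log 2 * (N - n) - F * Real.log 2 * (k * M) ≤
      S.filesEnt k {i | (i : ℕ) < n} - S.filesEnt k ∅ := by
  set T : Finset (Fin N) := {i | (i : ℕ) < n} with hT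
  have hTc : #Tᶜ = N - n := by
    rw [card_compl, hT, Fin.card_filter_val_lt, Fintype.card_fin]; omega
  have h1 : Real.log (Fintype.card S.Good) ≤
      ent fun w : S.Good => ((fun i : T => w.1 i), (fun i : (Tᶜ : Finset (Fin N)) => w.1 i)) := by
    rw [← ent_eq_log_card_of_injective]
    intro w w' h
    simp only [Prod.mk.injEq, funext_iff, Subtype.forall, mem_compl] at h
    refine Subtype.ext (funext fun i => ?_)
    by_cases hi : i ∈ T
    exacts [h.1 i hi, h.2 i hi]
  have h2 := ent_prod_le (fun w : S.Good => (fun i : T => w.1 i))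
    (fun w : S.Good => (fun i : (Tᶜ : Finset (Fin N)) => w.1 i))
  have h3 := ent_le_log_card (fun w : S.Good => (fun i : (Tᶜ : Finset (Fin N)) => w.1 i))
  have h4 : ent (fun w : S.Good => (fun i : T => w.1 i)) ≤ S.filesEnt k T :=
    ent_le_of_determines fun w w' h => (Prod.mk.inj h).1
  have h5 : S.filesEnt k ∅ = ent (S.caches k) := jointEnt_empty _ _
  have h6 := ent_le_log_card (S.caches k)
  have hcard : Fintype.card {i : Fin K // (i : ℕ) < k} = k := by
    rw [Fintype.card_subtype, Fin.card_filter_val_lt]; omega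
  rw [Fintype.card_fun, hcard, Nat.cast_pow, Real.log_pow] at h6
  rw [Fintype.card_fun, Fintype.card_coe, hTc, Nat.cast_pow, Real.log_pow, Nat.cast_sub hn,
    Fintype.card_fin, Nat.cast_pow, Real.log_pow, Nat.cast_ofNat] at h3
  have h7 := mul_le_mul_of_nonneg_left (log_two_pow_floor_le (F := F) hM) k.cast_nonneg
  linarith

lemma cutBound_le_add {p : Fin N → ℝ} (hp : ∀ n, 0 ≤ p n) (hs : ∑ n, p n = 1)
    (hanti : Antitone p) (hM : 0 ≤ M) (hR : ∀ d, 0 ≤ R d) {k : ℕ} (hk : k ≤ K) {δ : ℝ}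
    (hδ0 : 0 ≤ δ) (hδ1 : δ < 1) (hδ : (1 - δ) * Fintype.card (Files N F) ≤ Fintype.card S.Good) :
    F * Real.log 2 * cutBound p M k + Real.log (1 - δ) ≤
      F * Real.log 2 * ∑ d, iidLaw K p d * R d := by
  have hL : 0 ≤ F * Real.log 2 := mul_nonneg F.cast_nonneg (Real.log_nonneg one_le_two)
  have hlog : Real.log (1 - δ) ≤ 0 := Real.log_nonpos (by linarith) (by linarith)
  have hcard : Real.log (1 - δ) + F * Real.log 2 * N ≤ Real.log (Fintype.card S.Good) := by
    have h0 : (0 : ℝ) < Fintype.card (Files N F) := by exact_mod_cast Fintype.card_pos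
    have h := Real.log_le_log (mul_pos (by linarith) h0) hδ
    rw [Real.log_mul (by linarith) h0.ne'] at h
    simp only [Fintype.card_fun, Fintype.card_fin, Nat.cast_pow, Real.log_pow,
      Nat.cast_ofNat] at h
    linarith
  have h1 := sum_reqProb_mul_le (K := K) hp hs
    (jointEnt_submodular (fun w : S.Good => w.1) (S.caches k)) hk
  have h2 : ∑ d, iidLaw K p d * (S.filesEnt k (requested k d) - S.filesEnt k ∅) ≤
      ∑ d, iidLaw K p d * (F * Real.log 2 * R d) :=
    sum_le_sum fun d _ => mul_le_mul_of_nonneg_left (S.filesEnt_requested_le d (hR d))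
      (iidLaw_nonneg hp d)
  have h3 : ∑ n ∈ range N, (reqProb p k n - reqProb p k (n + 1)) *
      (F * Real.log 2 * max (((n + 1 : ℕ) : ℝ) - k * M) 0 + Real.log (1 - δ)) ≤
      ∑ n ∈ range N, (reqProb p k n - reqProb p k (n + 1)) *
        (S.filesEnt k {i | (i : ℕ) < n + 1} - S.filesEnt k ∅) := by
    refine sum_le_sum fun n hn => mul_le_mul_of_nonneg_left ?_
      (sub_nonneg.mpr (reqProb_antitone hp hs hanti k n))
    have h4 := S.le_filesEnt_sub hk (Nat.succ_le_of_lt (mem_range.mp hn)) hM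
    have h5 : S.filesEnt k ∅ ≤ S.filesEnt k {i | (i : ℕ) < n + 1} :=
      jointEnt_mono _ _ (empty_subset _)
    rcases max_cases (((n + 1 : ℕ) : ℝ) - k * M) 0 with h | h <;> rw [h.1]
    · rw [Nat.succ_eq_add_one] at h4
      linarith
    · linarith
  -- The weights telescope to `reqProb p k 0` ≤ 1, so the nonpositive loss is paid at most once.
  have h4 : Real.log (1 - δ) ≤
      ∑ n ∈ range N, (reqProb p k n - reqProb p k (n + 1)) * Real.log (1 - δ) := by
    rw [← sum_mul, sum_range_sub', reqProb_eq_zero, sub_zero]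
    nlinarith [reqProb_zero_le_one hp hs k]
  have h5 : F * Real.log 2 * cutBound p M k = ∑ n ∈ range N,
      (reqProb p k n - reqProb p k (n + 1)) *
        (F * Real.log 2 * max (((n + 1 : ℕ) : ℝ) - k * M) 0) := by
    rw [cutBound, mul_sum]
    exact sum_congr rfl fun n _ => by ring
  have h6 : ∑ d, iidLaw K p d * (F * Real.log 2 * R d) =
      F * Real.log 2 * ∑ d, iidLaw K p d * R d := by
    rw [mul_sum]
    exact sum_congr rfl fun d _ => by ring
  simp only [mul_add, sum_add_distrib] at h3
  rw [← h6, h5]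
  exact (add_le_add_right h4 _).trans (h3.trans (h1.trans h2))

end Scheme

/-! ### Vanishing error and passage to the closure. -/

section Converse

variable {p : Fin N → ℝ}

lemma cutBound_le_of_achievable (hp : ∀ n, 0 ≤ p n) (hs : ∑ n, p n = 1) (hanti : Antitone p)
    (h : Achievable N K M R) {k : ℕ} (hk : k ≤ K) :
    cutBound p M k ≤ ∑ d, iidLaw K p d * R d := by
  obtain ⟨hM, hR, h⟩ := h
  have hlog2 := Real.log_pos one_lt_two
  refine le_of_forall_pos_le_add fun η hη => ?_
  set c : ℝ := ((Fintype.card (Demand N K × Fin K) : ℕ) : ℝ)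
  have hc0 : 0 ≤ c := Nat.cast_nonneg _
  -- Chosen so that log (1 - δ) = -η log 2; after division by F log 2 the loss is at most η, since F
  -- ≥ 1.
  set δ : ℝ := 1 - Real.exp (-(η * Real.log 2)) with hδ
  have hδ0 : 0 < δ := sub_pos.mpr (Real.exp_zero ▸ Real.exp_lt_exp.mpr (by nlinarith))
  obtain ⟨F, hF, S, hS⟩ := h (δ / (c + 1)) (by positivity)
  have hcS : c * S.error ≤ δ := by
    rw [lt_div_iff₀ (by positivity)] at hS
    nlinarith [S.error_nonneg]
  have hδ1 : δ < 1 := by linarith [Real.exp_pos (-(η * Real.log 2))]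
  have hfiles : (0 : ℝ) < Fintype.card (Files N F) := by exact_mod_cast Fintype.card_pos
  classical
  have hcard : (1 - δ) * Fintype.card (Files N F) ≤ Fintype.card S.Good :=
    (mul_le_mul_of_nonneg_right (by linarith) hfiles.le).trans S.card_files_sub_le_card_good
  have : Nonempty S.Good := by
    rw [← Fintype.card_pos_iff, ← Nat.cast_pos (α := ℝ)]
    exact (mul_pos (by linarith) hfiles).trans_le hcard
  have key := S.cutBound_le_add hp hs hanti hM hR hk hδ0.le hδ1 hcard
  rw [show 1 - δ = Real.exp (-(η * Real.log 2)) by rw [hδ]; ring, Real.log_exp] at key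
  have hF1 : (1 : ℝ) ≤ F := by exact_mod_cast hF
  have hFL : 0 < F * Real.log 2 := by positivity
  refine le_of_mul_le_mul_left ?_ hFL
  nlinarith [mul_pos hη hlog2]

lemma continuous_cutBound (k : ℕ) : Continuous fun M => cutBound p M k := by
  unfold cutBound
  fun_prop

lemma cutBound_le_of_mem_rateRegion (hp : ∀ n, 0 ≤ p n) (hs : ∑ n, p n = 1)
    (hanti : Antitone p) (h : (M, R) ∈ rateRegion N K) {k : ℕ} (hk : k ≤ K) :
    cutBound p M k ≤ ∑ d, iidLaw K p d * R d := by
  have hcl : IsClosed {x : ℝ × (Demand N K → ℝ) |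
      cutBound p x.1 k ≤ ∑ d, iidLaw K p d * x.2 d} :=
    isClosed_le ((continuous_cutBound k).comp continuous_fst) (by fun_prop)
  exact closure_minimal (fun x hx => cutBound_le_of_achievable hp hs hanti hx hk) hcl h

end Converse

/-! ### Attainment of the minimum by compactness. -/

section Attainment

lemma exists_injective_files {r : ℝ} (hr : (N : ℝ) ≤ r) :
    ∃ e : Files N F → Fin (2 ^ ⌊(F : ℝ) * r⌋₊), Function.Injective e := by
  obtain ⟨e⟩ : Nonempty (Files N F ↪ Fin (2 ^ ⌊(F : ℝ) * r⌋₊)) := by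
    rw [Function.Embedding.nonempty_iff_card_le]
    simp only [Fintype.card_fun, Fintype.card_fin, ← pow_mul]
    refine Nat.pow_le_pow_right two_pos (Nat.le_floor ?_)
    push_cast
    gcongr
  exact ⟨e, e.injective⟩

/-- Updates at rates above `N` can be replaced by the whole library. -/
lemma Scheme.exists_truncate (S : Scheme N K F M R) :
    ∃ S' : Scheme N K F M (fun d => min (R d) N), S'.error ≤ S.error := by
  have key (d : Demand N K) : ∃ (u : Files N F → Fin (2 ^ ⌊(F : ℝ) * min (R d) N⌋₊))
      (g : Fin K → Fin (2 ^ ⌊(F : ℝ) * M⌋₊) → Fin (2 ^ ⌊(F : ℝ) * min (R d) N⌋₊) → Fin (2 ^ F)),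
      ∀ k w, g k (S.cache k w) (u w) ≠ w (d k) → S.estimate d k w ≠ w (d k) := by
    rcases le_total (R d) N with h | h
    · rw [min_eq_left h]
      exact ⟨S.update d, fun k => S.decode k d, fun k w h => h⟩
    · obtain ⟨e, he⟩ := exists_injective_files (N := N) (F := F) (r := min (R d) N)
        (min_eq_right h).ge
      refine ⟨e, fun k _ x => Function.invFun e x (d k), fun k w h => (h ?_).elim⟩
      exact congrFun (Function.leftInverse_invFun he w) (d k)
  choose u g hug using key
  refine ⟨⟨S.cache, u, fun k d => g d k⟩, ?_⟩
  refine ciSup_mono (Set.finite_range _).bddAbove fun q => ?_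
  unfold Scheme.userError
  refine div_le_div_of_nonneg_right (Nat.cast_le.mpr (card_le_card fun w hw => ?_))
    (Nat.cast_nonneg _)
  simp only [mem_filter, mem_univ, true_and] at hw ⊢
  exact hug q.1 q.2 w hw

lemma Achievable.truncate (h : Achievable N K M R) :
    Achievable N K M (fun d => min (R d) N) := by
  obtain ⟨hM, hR, h⟩ := h
  refine ⟨hM, fun d => le_min (hR d) N.cast_nonneg, fun ε hε => ?_⟩
  obtain ⟨F, hF, S, hS⟩ := h ε hε
  obtain ⟨S', hS'⟩ := S.exists_truncate
  exact ⟨F, hF, S', hS'.trans_lt hS⟩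

lemma achievable_const (hM : 0 ≤ M) : Achievable N K M (fun _ => (N : ℝ)) := by
  refine ⟨hM, fun _ => N.cast_nonneg, fun ε hε => ⟨1, le_rfl, ?_⟩⟩
  obtain ⟨e, he⟩ := exists_injective_files (N := N) (F := 1) (r := N) le_rfl
  have z : Fin (2 ^ ⌊((1 : ℕ) : ℝ) * M⌋₊) := ⟨0, by positivity⟩
  refine ⟨⟨fun _ _ => z, fun _ => e, fun k d _ x => Function.invFun e x (d k)⟩, ?_⟩
  refine lt_of_le_of_lt (Real.iSup_le (fun q => ?_) le_rfl) hε
  simp [Scheme.userError, Scheme.estimate, Function.leftInverse_invFun he _]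

lemma rateRegion_truncate (h : (M, R) ∈ rateRegion N K) :
    (M, fun d => min (R d) N) ∈ rateRegion N K := by
  have hc : Continuous fun x : ℝ × (Demand N K → ℝ) => (x.1, fun d => min (x.2 d) (N : ℝ)) := by
    fun_prop
  exact map_mem_closure (f := fun x : ℝ × (Demand N K → ℝ) => (x.1, fun d => min (x.2 d) (N : ℝ)))
    hc h fun x hx => Achievable.truncate hx

lemma nonneg_of_mem_rateRegion (h : (M, R) ∈ rateRegion N K) (d : Demand N K) : 0 ≤ R d := by
  have hcl : IsClosed {x : ℝ × (Demand N K → ℝ) | 0 ≤ x.2 d} :=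
    isClosed_le continuous_const (by fun_prop)
  exact closure_minimal (fun x hx => hx.2.1 d) hcl h

lemma isLeast_avgRates {q : Demand N K → ℝ} (hq : ∀ d, 0 ≤ q d) (hM : 0 ≤ M) :
    IsLeast (avgRates q M) (optAvgRate q M) := by
  let C : Set (Demand N K → ℝ) :=
    (Set.univ.pi fun _ => Set.Icc (0 : ℝ) N) ∩ {R | (M, R) ∈ rateRegion N K}
  have hC : IsCompact C := (isCompact_univ_pi fun _ => isCompact_Icc).inter_right
    (isClosed_closure.preimage (by fun_prop : Continuous fun R : Demand N K → ℝ => (M, R)))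
  have hne : C.Nonempty := ⟨fun _ => N, fun _ _ => ⟨N.cast_nonneg, le_rfl⟩,
    subset_closure (achievable_const hM)⟩
  obtain ⟨R₀, hR₀, hmin⟩ := hC.exists_isMinOn hne
    (f := fun R : Demand N K → ℝ => ∑ d, q d * R d) (by fun_prop)
  have hleast : IsLeast (avgRates q M) (∑ d, q d * R₀ d) := by
    refine ⟨⟨R₀, hR₀.2, rfl⟩, ?_⟩
    rintro _ ⟨R, hR, rfl⟩
    -- Truncation moves any competitor into C without raising its average, as q ≥ 0.
    have h1 : (fun d => min (R d) (N : ℝ)) ∈ C :=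
      ⟨fun d _ => ⟨le_min (nonneg_of_mem_rateRegion hR d) N.cast_nonneg, min_le_right _ _⟩,
        rateRegion_truncate hR⟩
    exact (hmin h1).trans
      (sum_le_sum fun d _ => mul_le_mul_of_nonneg_left (min_le_left _ _) (hq d))
  rw [optAvgRate, hleast.csInf_eq]
  exact hleast

end Attainment

end CodedCaching

theorem theorem1 (N K : ℕ) (hK : 1 ≤ K) (p : Fin N → ℝ) (hp_nonneg : ∀ n, 0 ≤ p n)
    (hp_sum : ∑ n, p n = 1) (hp_sorted : Antitone p) (M : ℝ) (hM : 0 ≤ M) :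
    IsLeast (CodedCaching.avgRates (CodedCaching.iidLaw K p) M)
        (CodedCaching.optAvgRate (CodedCaching.iidLaw K p) M) ∧
      (Finset.Icc 1 K).sup' (Finset.nonempty_Icc.mpr hK) (CodedCaching.cutBound p M) ≤
        CodedCaching.optAvgRate (CodedCaching.iidLaw K p) M := by
  have h := CodedCaching.isLeast_avgRates (CodedCaching.iidLaw_nonneg (K := K) hp_nonneg) hM
  refine ⟨h, Finset.sup'_le _ _ fun k hk => ?_⟩
  obtain ⟨R, hR, hr⟩ := h.1
  rw [hr]
  exact CodedCaching.cutBound_le_of_mem_rateRegion hp_nonneg hp_sum hp_sorted hR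
    (Finset.mem_Icc.mp hk).2
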